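/- Let $\mathfrak{s}(1/1)$ be the complex Lie superalgebra with even basis $H,D,K,P,G,M$ and odd basis $\mathcal Q,\mathcal S,\mathcal X$, whose nonzero (anti)commutators are, up to supersymmetry, $$[H,D]=2H,\ [H,K]=D,\ [D,K]=2K,\ [P,G]=M,\ [H,G]=P,\ [D,G]=G,\ [P,D]=P,\ [P,K]=G,$$ $$\{\mathcal Q,\mathcal Q\}=-2H,\ \{\mathcal S,\mathcal S\}=-2K,\ \{\mathcal X,\mathcal X\}=-M,\ \{\mathcal Q,\mathcal X\}=-P,\ \{\mathcal S,\mathcal X\}=-G,\ \{\mathcal Q,\mathcal S\}=-D,$$ $$[\mathcal Q,D]=\mathcal Q,\ [\mathcal Q,K]=\mathcal S,\ [D,\mathcal S]=\mathcal S,\ [H,\mathcal S]=\mathcal Q,\ [\mathcal Q,G]=\mathcal X,\ [P,\mathcal S]=\mathcal X .$$ Grade it by $\deg K=2$, $\deg G=\deg\mathcal S=1$, $\deg D=\deg M=\deg\mathcal X=0$, $\deg P=\deg\mathcal Q=-1$, $\deg H=-2$. Fix $d\in\mathbb R$ and $0\neq m\in\mathbb C$, and let $\chi$ be an odd scalar with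 $2\chi^2=m$: it commutes with the even elements and anticommutes with the odd elements of $\mathfrak{s}(1/1)$. All modules are modules over $\mathfrak{s}(1/1)$ with scalars $\mathbb C[\chi]$, that is, left modules over $U(\mathfrak{s}(1/1))\,\hat\otimes\,\mathbb C[\chi]$ (super tensor product); submodules, irreducibility and isomorphisms refer to this action. A lowest weight module of weight $d$ and mass $m$ is a module generated by a vector $v_0\ne0$ that is annihilated by all elements of negative degree and satisfies $Dv_0=-d\,v_0$, $Mv_0=m\,v_0$, $\mathcal Xv_0=\chi v_0$. The Verma module $V^d$ is the universal such module (the quotient of $U(\mathfrak{s}(1/1))\,\hat\otimes\,\mathbb C[\chi]$ by the left ideal generated by these conditions). A singular vector of $V^d$ is an eigenvector of $D$, not of the form $(a+b\chi)v_0$ with $a,b\in\mathbb C$, that is annihilated by all elements of negative degree. Then: 1. $V^d$ is a lowest weight module, and it is irreducible if and only if $d+\tfrac12\notin\mathbb Z_{\ge0}$. 2. If $d+\tfrac12\in\mathbb Z_{\ge0}$, then $v_s=(G^2-2mK)^{d+1/2}(G-2\chi\mathcal S)v_0$ is a singular vector of $V^d$, and the quotient $V^d/\mathcal I$ by the submodule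 $\mathcal I$ generated by $v_s$ is an irreducible lowest weight module. 3. These are all: every irreducible lowest weight module of weight $d$ and mass $m$ is isomorphic, by an isomorphism matching the lowest weight vectors, to $V^d$ if $d+\tfrac12\notin\mathbb Z_{\ge0}$ and to $V^d/\mathcal I$ if $d+\tfrac12\in\mathbb Z_{\ge0}$. 4. All of these irreducible modules ($V^d$ for $d+\tfrac12\notin\mathbb Z_{\ge0}$ and $V^d/\mathcal I$ for $d+\tfrac12\in\mathbb Z_{\ge0}$) are infinite dimensional over $\mathbb C$. -/

import Mathlib

namespace SuperSchrodinger

/-- The basis of the `N = 1` super Schrödinger algebra `s(1/1)` in `(1+1)`-dimensional spacetime: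
`H, D, K, P, G, M` are even, `Q, S, X` are odd. -/
inductive Gen
  | H | D | K | P | G | M | Q | S | X
  deriving DecidableEq

instance : Fintype Gen where
  elems := {.H, .D, .K, .P, .G, .M, .Q, .S, .X}
  complete x := by cases x <;> decide

/-- The odd basis elements. -/
def Gen.isOdd : Gen → Bool
  | .Q | .S | .X => true
  | _ => false

/-- The sign `(-1)^{|x||y|}`. -/
def sgn (x y : Gen) : ℤ := if x.isOdd && y.isOdd then -1 else 1

/-- The degree that makes `s(1/1)` a `ℤ`-graded Lie superalgebra; its negative, zero and positive
parts are the triangular decomposition. -/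
def Gen.deg : Gen → ℤ
  | .K => 2
  | .G | .S => 1
  | .D | .M | .X => 0
  | .P | .Q => -1
  | .H => -2

/-- The Lie superbracket of two basis elements, given by its coefficients on the basis:
the commutator, or the anticommutator if both elements are odd.  Pairs that are not listed
have bracket zero. -/
def bracket : Gen → Gen → (Gen → ℤ)
  -- even-even
  | .H, .D => Pi.single .H 2
  | .D, .H => Pi.single .H (-2)
  | .H, .K => Pi.single .D 1
  | .K, .H => Pi.single .D (-1)
  | .D, .K => Pi.single .K 2
  | .K, .D => Pi.single .K (-2)
  | .P, .G => Pi.single .M 1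
  | .G, .P => Pi.single .M (-1)
  | .H, .G => Pi.single .P 1
  | .G, .H => Pi.single .P (-1)
  | .D, .G => Pi.single .G 1
  | .G, .D => Pi.single .G (-1)
  | .P, .D => Pi.single .P 1
  | .D, .P => Pi.single .P (-1)
  | .P, .K => Pi.single .G 1
  | .K, .P => Pi.single .G (-1)
  -- odd-odd
  | .Q, .Q => Pi.single .H (-2)
  | .S, .S => Pi.single .K (-2)
  | .X, .X => Pi.single .M (-1)
  | .Q, .X => Pi.single .P (-1)
  | .X, .Q => Pi.single .P (-1)
  | .S, .X => Pi.single .G (-1)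
  | .X, .S => Pi.single .G (-1)
  | .Q, .S => Pi.single .D (-1)
  | .S, .Q => Pi.single .D (-1)
  -- odd-even and even-odd
  | .Q, .D => Pi.single .Q 1
  | .D, .Q => Pi.single .Q (-1)
  | .Q, .K => Pi.single .S 1
  | .K, .Q => Pi.single .S (-1)
  | .D, .S => Pi.single .S 1
  | .S, .D => Pi.single .S (-1)
  | .H, .S => Pi.single .Q 1
  | .S, .H => Pi.single .Q (-1)
  | .Q, .G => Pi.single .X 1
  | .G, .Q => Pi.single .X (-1)
  | .P, .S => Pi.single .X 1
  | .S, .P => Pi.single .X (-1)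
  | _, _ => 0

/-- Letters of the free algebra: `some x` is the basis element `x` of `s(1/1)`, and `none` is the
odd parameter `χ`. -/
abbrev letter (a : Option Gen) : FreeAlgebra ℂ (Option Gen) := FreeAlgebra.ι ℂ a

/-- The relations of the enveloping algebra of `s(1/1)` with scalars extended by an odd parameter
`χ`, `χ² = m/2`. -/
inductive Rel (m : ℂ) : FreeAlgebra ℂ (Option Gen) → FreeAlgebra ℂ (Option Gen) → Prop
  /-- `x y - (-1)^{|x||y|} y x = [x, y]` -/
  | super_bracket (x y : Gen) : Rel m
      (letter (some x) * letter (some y) - (sgn x y : ℂ) • (letter (some y) * letter (some x)))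
      (∑ z, (bracket x y z : ℂ) • letter (some z))
  /-- The odd scalar `χ` commutes with even elements and anticommutes with odd elements. -/
  | chi_comm (x : Gen) : Rel m
      (letter none * letter (some x))
      ((if x.isOdd then (-1 : ℂ) else 1) • (letter (some x) * letter none))
  /-- `m = 2 χ²` -/
  | chi_sq : Rel m (letter none * letter none) (algebraMap ℂ _ (m / 2))

/-- The graded tensor product `U(s(1/1)) ⊗ ℂ[χ]`, where `χ` is odd and `χ² = m/2`.  Its left
modules are the representations of `s(1/1)` on which the odd parameter `χ` acts as a scalar. -/
abbrev Env (m : ℂ) : Type := RingQuot (Rel m)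

/-- The image of a basis element of `s(1/1)`. -/
noncomputable def gen (m : ℂ) (x : Gen) : Env m := RingQuot.mkAlgHom ℂ (Rel m) (letter (some x))

/-- The odd scalar `χ`. -/
noncomputable def chi (m : ℂ) : Env m := RingQuot.mkAlgHom ℂ (Rel m) (letter none)

/-- An ordinary (even) scalar. -/
noncomputable abbrev scal (m c : ℂ) : Env m := algebraMap ℂ (Env m) c

/-- `v` is a lowest weight vector of conformal weight `d` and mass `m`: it is nonzero,
`s(1/1)⁻ v = 0`, `D v = -d v`, `M v = m v` and `X v = χ v`. -/
structure IsLowestWeightVector (d : ℝ) (m : ℂ) {V : Type*} [AddCommGroup V] [Module (Env m) V]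
    (v : V) : Prop where
  ne_zero : v ≠ 0
  neg_smul : ∀ x : Gen, x.deg < 0 → gen m x • v = 0
  D_smul : gen m .D • v = scal m (-(d : ℂ)) • v
  M_smul : gen m .M • v = scal m m • v
  X_smul : gen m .X • v = chi m • v

/-- `V` is a lowest weight module with lowest weight vector `v`: such a `v` generates `V`. -/
structure IsLowestWeightModule (d : ℝ) (m : ℂ) (V : Type*) [AddCommGroup V] [Module (Env m) V]
    (v : V) : Prop where
  lowest : IsLowestWeightVector d m v
  span_eq_top : Submodule.span (Env m) {v} = ⊤

/-- The left ideal generated by the lowest weight conditions. -/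
noncomputable def vermaIdeal (d : ℝ) (m : ℂ) : Submodule (Env m) (Env m) :=
  Submodule.span (Env m)
    ({a | ∃ x : Gen, x.deg < 0 ∧ a = gen m x} ∪
      {gen m .D - scal m (-(d : ℂ)), gen m .M - scal m m, gen m .X - chi m})

/-- The Verma module `V^d`: the module induced from the lowest weight. -/
abbrev Verma (d : ℝ) (m : ℂ) : Type := Env m ⧸ vermaIdeal d m

/-- The vector `v₀` of the Verma module. -/
noncomputable def vac (d : ℝ) (m : ℂ) : Verma d m := (vermaIdeal d m).mkQ 1

/-- A singular vector of the Verma module: a `D`-homogeneous vector killed by `s(1/1)⁻` that is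
not a scalar multiple `(a + b χ) v₀` of the lowest weight vector. -/
structure IsSingularVector (d : ℝ) (m : ℂ) (v : Verma d m) : Prop where
  homogeneous : ∃ c : ℂ, gen m .D • v = scal m c • v
  not_multiple : ∀ a b : ℂ, v ≠ (scal m a + scal m b * chi m) • vac d m
  neg_smul : ∀ x : Gen, x.deg < 0 → gen m x • v = 0

/-- The vector `(G² - 2mK)ⁿ (G - 2χS) v₀`. -/
noncomputable def singVec (d : ℝ) (m : ℂ) (n : ℕ) : Verma d m :=
  ((gen m .G ^ 2 - scal m (2 * m) * gen m .K) ^ n *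
    (gen m .G - scal m 2 * chi m * gen m .S)) • vac d m

/-- The submodule of the Verma module generated by `(G² - 2mK)ⁿ (G - 2χS) v₀`. -/
noncomputable def singSub (d : ℝ) (m : ℂ) (n : ℕ) : Submodule (Env m) (Verma d m) :=
  Submodule.span (Env m) {singVec d m n}

/-- The quotient `V^d / I`. -/
abbrev VermaQuot (d : ℝ) (m : ℂ) (n : ℕ) : Type := Verma d m ⧸ singSub d m n

/-- The image of `v₀` in `V^d / I`. -/
noncomputable def vacQuot (d : ℝ) (m : ℂ) (n : ℕ) : VermaQuot d m n :=
  (singSub d m n).mkQ (vac d m)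

end SuperSchrodinger

open SuperSchrodinger

universe u

/-!
At mass `m ≠ 0` the algebra `s(1/1)` decouples. Put `s = S - m⁻¹ G X` and `q = Q - m⁻¹ P X`. On a
module on which `M` acts by `m`, the operators `P, G` form a Heisenberg pair, `X, χ` are
anticommuting Clifford generators, and `s, q` generate a copy of `osp(1|2)` that commutes with `P,
G` and anticommutes with `X, χ`. Conversely such operators (`Decoupling`) define a representation
of the enveloping algebra (`Decoupling.lift`).

The Verma module therefore has the basis `Gᵃ sᵏ χ^ε v₀` (`vermaBasis`): the commutation relations
show that these monomials span, and the Fock representation, in which they act as shifts on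
functions, shows that they are linearly independent. Here `P` lowers `a` with the nonzero
coefficient `m a`, and `q` lowers `k` with the coefficient `lowerCoeff d k`, which is `-j` for `k
= 2 j` and `d + 1/2 - j` for `k = 2 j + 1`.

The operators `G P`, `q s + s q` and `X χ` are diagonal in this basis and separate its elements,
so a submodule contains every monomial that occurs in one of its vectors
(`basis_mem_of_repr_ne_zero`). From there `P`, `q` and `χ` lead down to `v₀`, unless a coefficient
`lowerCoeff d k` vanishes. That happens only for `k = 2 n + 1` with `d + 1/2 = n`. In this case
`(G² - 2 m K)ⁿ (G - 2 χ S) v₀` is a nonzero multiple of `s²ⁿ⁺¹ χ v₀`, it generates the span of the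
monomials with `k > 2 n` (`mem_singSub_iff`), and every submodule not contained in that span is
the whole module (`eq_top_of_not_le_singSub`). So it is the unique maximal submodule, which gives
the classification. Infinite dimensionality is a trace argument: `[P, G] = m` is impossible for
matrices.
-/

namespace SuperSchrodinger

/-! ### Representations from a Heisenberg pair, Clifford generators and a copy of `osp(1|2)` -/

lemma sum_gen {A : Type*} [AddCommGroup A] (f : Gen → A) : ∑ z, f z =
    f .H + f .D + f .K + f .P + f .G + f .M + f .Q + f .S + f .X := by
  have : (Finset.univ : Finset Gen) = {.H, .D, .K, .P, .G, .M, .Q, .S, .X} := rfl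
  rw [this]
  simp [Finset.sum_insert, add_assoc]

/-- Elements of an associative algebra that decouple `s(1/1)` at mass `m`: a Heisenberg pair `p, g`,
two anticommuting Clifford generators `X, χ`, and odd generators `q, s` of a copy of `osp(1|2)`.
The pair `p, g` commutes with everything else, and `X, χ` anticommute with `q, s`.  The two cubic
relations say `[q, K] = s` and `[H, s] = q` for `K = -s²`, `H = -q²`; no other relation
of `osp(1|2)` is needed. -/
structure Decoupling (A : Type*) [Ring A] [Algebra ℂ A] (m : ℂ) where
  /-- the Heisenberg raising element -/
  g : A
  /-- the Heisenberg lowering element -/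
  p : A
  /-- the odd raising element of `osp(1|2)` -/
  s : A
  /-- the odd lowering element of `osp(1|2)` -/
  q : A
  /-- the Clifford generator of square `-m/2` -/
  X : A
  /-- the Clifford generator of square `m/2` -/
  chi : A
  p_g : p * g = g * p + m • 1
  s_g : s * g = g * s
  q_g : q * g = g * q
  X_g : X * g = g * X
  s_p : s * p = p * s
  q_p : q * p = p * q
  X_p : X * p = p * X
  X_s : X * s = -(s * X)
  X_q : X * q = -(q * X)
  X_X : X * X = -(m / 2) • 1
  q_s_s : q * (s * s) = s * (s * q) - s
  q_q_s : q * (q * s) = s * (q * q) - q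
  chi_g : chi * g = g * chi
  chi_p : chi * p = p * chi
  chi_s : chi * s = -(s * chi)
  chi_q : chi * q = -(q * chi)
  chi_X : chi * X = -(X * chi)
  chi_chi : chi * chi = (m / 2) • 1

namespace Decoupling

variable {A : Type*} [Ring A] [Algebra ℂ A] {m : ℂ}

/-- The basis elements of `s(1/1)` in terms of decoupled elements: the Heisenberg algebra together
with `X` carries an `osp(1|2)` of its own, which is added to the one generated by `q` and `s`. -/
noncomputable def gen (F : Decoupling A m) : Gen → A
  | .P => F.p
  | .G => F.g
  | .M => m • 1
  | .X => F.X
  | .Q => F.q + m⁻¹ • (F.p * F.X)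
  | .S => F.s + m⁻¹ • (F.g * F.X)
  | .H => -(F.q * F.q) + (2 * m)⁻¹ • (F.p * F.p)
  | .K => -(F.s * F.s) + (2 * m)⁻¹ • (F.g * F.g)
  | .D => -(F.q * F.s + F.s * F.q) + (2 * m)⁻¹ • (F.p * F.g + F.g * F.p)

set_option maxHeartbeats 4000000 in
lemma gen_bracket (F : Decoupling A m) (hm : m ≠ 0) (x y : Gen) :
    F.gen x * F.gen y - (sgn x y : ℂ) • (F.gen y * F.gen x)
      = ∑ z, (bracket x y z : ℂ) • F.gen z := by
  rw [sum_gen]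
  obtain ⟨g, p, s, q, X, chi, p_g, s_g, q_g, X_g, s_p, q_p, X_p, X_s, X_q, X_X, q_s_s, q_q_s,
    -, -, -, -, -, -⟩ := F
  -- Each relation is a rewrite rule towards the order `g, p, s, q, X`; the variant with a
  -- trailing factor applies inside right-associated products.
  have trail {a b c : A} (h : a * b = c) (x : A) : a * (b * x) = c * x := by
    rw [← mul_assoc, h]
  have q_s_s' (x : A) : q * (s * (s * x)) = s * (s * (q * x)) - s * x := by
    simpa [mul_assoc, sub_mul] using congrArg (· * x) q_s_s
  have q_q_s' (x : A) : q * (q * (s * x)) = s * (q * (q * x)) - q * x := by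
    simpa [mul_assoc, sub_mul] using congrArg (· * x) q_q_s
  cases x <;> cases y <;>
    simp only [sgn, bracket, Gen.isOdd, gen, mul_assoc, mul_add, add_mul, mul_sub,
      smul_mul_assoc, mul_smul_comm, neg_mul, mul_neg, smul_add, smul_sub, smul_neg, neg_neg,
      mul_one, one_mul, smul_smul, p_g, s_g, q_g, X_g, s_p, q_p, X_p, X_s, X_q, X_X,
      trail p_g, trail s_g, trail q_g, trail X_g, trail s_p, trail q_p, trail X_p,
      trail X_s, trail X_q, q_s_s, q_q_s, q_s_s', q_q_s', neg_smul,
      Pi.single_apply, reduceCtorEq, if_true, if_false, Int.cast_zero, Int.cast_one, Int.cast_neg,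
      Int.cast_ofNat, zero_smul, add_zero, zero_add, one_smul, Pi.zero_apply, Bool.and_self,
      Bool.and_false, Bool.false_and, Bool.false_eq_true] <;>
    match_scalars <;> field_simp <;> ring

lemma chi_gen (F : Decoupling A m) (x : Gen) :
    F.chi * F.gen x = (if x.isOdd then (-1 : ℂ) else 1) • (F.gen x * F.chi) := by
  obtain ⟨g, p, s, q, X, chi, -, -, -, -, -, -, -, -, -, -, -, -,
    chi_g, chi_p, chi_s, chi_q, chi_X, -⟩ := F
  have trail {a b c : A} (h : a * b = c) (x : A) : a * (b * x) = c * x := by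
    rw [← mul_assoc, h]
  cases x <;>
    simp only [Gen.isOdd, gen, mul_assoc, mul_add, add_mul, smul_mul_assoc, mul_smul_comm, neg_mul,
      mul_neg, smul_add, smul_neg, neg_neg, mul_one, one_mul, chi_g, chi_p, chi_s, chi_q, chi_X,
      trail chi_g, trail chi_p, trail chi_s, trail chi_q, if_true, if_false, neg_smul, one_smul,
      Bool.false_eq_true, neg_add]

/-- The image of the free generators: `none` goes to `χ`. -/
noncomputable def onLetters (F : Decoupling A m) : Option Gen → A
  | none => F.chi
  | some x => F.gen x

/-- Decoupled elements of `A` define a homomorphism from the enveloping algebra to `A`. -/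
noncomputable def lift (F : Decoupling A m) (hm : m ≠ 0) : Env m →ₐ[ℂ] A :=
  RingQuot.liftAlgHom ℂ ⟨FreeAlgebra.lift ℂ F.onLetters, by
    rintro _ _ (⟨x, y⟩ | ⟨x⟩ | _)
    · simpa [onLetters] using F.gen_bracket hm x y
    · cases h : x.isOdd <;> simpa [onLetters, h] using F.chi_gen x
    · simpa [onLetters, Algebra.algebraMap_eq_smul_one] using F.chi_chi⟩

lemma lift_gen (F : Decoupling A m) (hm : m ≠ 0) (x : Gen) :
    F.lift hm (SuperSchrodinger.gen m x) = F.gen x := by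
  simp [lift, SuperSchrodinger.gen, onLetters]

lemma lift_chi (F : Decoupling A m) (hm : m ≠ 0) : F.lift hm (SuperSchrodinger.chi m) = F.chi := by
  simp [lift, SuperSchrodinger.chi, onLetters]

end Decoupling

/-! ### The Fock model -/

/-- The space of functions on `ℤ × ℤ × Bool`, as a carrier for the Fock representation.  The
function supported at `(a, k, ε)` plays the role of `gᵃ sᵏ χ^ε v₀`.  Negative exponents are
allowed, so that shifts need no case distinction at the boundary; the Verma module only meets the
part with nonnegative exponents. -/
def FockSpace (_d : ℝ) (_m : ℂ) : Type := ℤ × ℤ × Bool → ℂ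

noncomputable instance (d : ℝ) (m : ℂ) : AddCommGroup (FockSpace d m) :=
  inferInstanceAs (AddCommGroup (ℤ × ℤ × Bool → ℂ))

noncomputable instance (d : ℝ) (m : ℂ) : Module ℂ (FockSpace d m) :=
  inferInstanceAs (Module ℂ (ℤ × ℤ × Bool → ℂ))

/-- The coefficient in `q sᵏ v₀ = lowerCoeff d k • sᵏ⁻¹ v₀`: it is `-j` for `k = 2 j` and
`d + 1/2 - j` for `k = 2 j + 1`. -/
noncomputable def lowerCoeff (d : ℝ) (k : ℤ) : ℂ :=
  -(k : ℂ) / 2 + (1 - (-1) ^ k) / 2 * (d + 1)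

section Operators

variable (d : ℝ) (m : ℂ)

/-- The operator that shifts a function on `ℤ × ℤ × Bool` and multiplies it by a weight. -/
noncomputable def weightedShift (i j : ℤ) (φ : Bool → Bool) (c : ℤ → ℤ → Bool → ℂ) :
    Module.End ℂ (FockSpace d m) where
  toFun f := fun x => c x.1 x.2.1 x.2.2 * f (x.1 + i, x.2.1 + j, φ x.2.2)
  map_add' f g := by
    funext x
    exact mul_add _ _ _
  map_smul' r f := by
    funext x
    exact mul_left_comm _ _ _

lemma weightedShift_apply (i j : ℤ) (φ : Bool → Bool) (c : ℤ → ℤ → Bool → ℂ) (f : FockSpace d m)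
    (a k : ℤ) (e : Bool) :
    weightedShift d m i j φ c f (a, k, e) = c a k e * f (a + i, k + j, φ e) := rfl

lemma fock_add_apply (f g : FockSpace d m) (x) : (f + g) x = f x + g x := rfl
lemma fock_sub_apply (f g : FockSpace d m) (x) : (f - g) x = f x - g x := rfl
lemma fock_neg_apply (f : FockSpace d m) (x) : (-f) x = -f x := rfl
lemma fock_smul_apply (c : ℂ) (f : FockSpace d m) (x) : (c • f) x = c * f x := rfl

/-- The decoupled operators of the Fock representation.  They act on coefficient functions, so raising
an exponent means evaluating at the exponent lowered by one, and conversely. -/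
noncomputable def fockDecoupling : Decoupling (Module.End ℂ (FockSpace d m)) m := by
  refine
  { g := weightedShift d m (-1) 0 id fun _ _ _ => 1
    p := weightedShift d m 1 0 id fun a _ _ => m * (a + 1)
    s := weightedShift d m 0 (-1) id fun _ _ _ => 1
    q := weightedShift d m 0 1 id fun _ k _ => lowerCoeff d (k + 1)
    X := weightedShift d m 0 0 not fun _ k e => (-1) ^ k * (if e then 1 else -(m / 2))
    chi := weightedShift d m 0 0 not fun _ k e => (-1) ^ k * (if e then 1 else m / 2)
    p_g := ?_, s_g := ?_, q_g := ?_, X_g := ?_, s_p := ?_, q_p := ?_, X_p := ?_, X_s := ?_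
    X_q := ?_, X_X := ?_, q_s_s := ?_, q_q_s := ?_, chi_g := ?_, chi_p := ?_, chi_s := ?_
    chi_q := ?_, chi_X := ?_, chi_chi := ?_ }
  all_goals
    refine LinearMap.ext fun f => funext fun ⟨a, k, e⟩ => ?_
    have h1 : (-1 : ℂ) ≠ 0 := by norm_num
    have hs : (-1 : ℂ) ^ k * (-1) ^ k = 1 := by rw [← mul_zpow]; simp
    cases e <;>
    simp [weightedShift_apply, Module.End.mul_apply, LinearMap.add_apply, LinearMap.sub_apply,
      fock_add_apply, fock_sub_apply, fock_neg_apply, fock_smul_apply, lowerCoeff, zpow_add₀ h1] <;>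
    grind

variable [NeZero m]

noncomputable instance : Module (Env m) (FockSpace d m) :=
  Module.compHom _ ((fockDecoupling d m).lift (NeZero.ne m)).toRingHom

lemma fock_smul (a : Env m) (f : FockSpace d m) :
    a • f = (fockDecoupling d m).lift (NeZero.ne m) a f := rfl

instance : IsScalarTower ℂ (Env m) (FockSpace d m) where
  smul_assoc c a f := by simp [fock_smul]

/-- The function supported at one point, with value `1` there. -/
noncomputable def delta (a k : ℤ) (e : Bool) : FockSpace d m :=
  fun x => if x = (a, k, e) then 1 else 0

end Operators

/-! ### Relations on modules of mass `m` -/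

section Env

variable (m : ℂ)

lemma gen_mul_gen (x y : Gen) :
    gen m x * gen m y =
      (sgn x y : ℂ) • (gen m y * gen m x) + ∑ z, (bracket x y z : ℂ) • gen m z := by
  have h := RingQuot.mkAlgHom_rel ℂ (Rel.super_bracket (m := m) x y)
  simp only [map_sub, map_mul, map_smul, map_sum] at h
  exact sub_eq_iff_eq_add'.mp h

lemma chi_mul_gen (x : Gen) :
    chi m * gen m x = (if x.isOdd then (-1 : ℂ) else 1) • (gen m x * chi m) := by
  have h := RingQuot.mkAlgHom_rel ℂ (Rel.chi_comm (m := m) x)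
  simp only [map_mul, map_smul] at h
  exact h

lemma chi_mul_chi : chi m * chi m = (m / 2) • 1 := by
  have h := RingQuot.mkAlgHom_rel ℂ (Rel.chi_sq (m := m))
  rw [map_mul, AlgHom.commutes] at h
  exact h.trans (Algebra.algebraMap_eq_smul_one _)

variable {m}

/-- A property of elements of the enveloping algebra may be checked on generators. -/
lemma env_induction {C : Env m → Prop} (hscal : ∀ c, C (scal m c)) (hgen : ∀ x, C (gen m x))
    (hchi : C (chi m)) (hadd : ∀ a b, C a → C b → C (a + b)) (hmul : ∀ a b, C a → C b → C (a * b))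
    (a : Env m) : C a := by
  obtain ⟨a, rfl⟩ := RingQuot.mkAlgHom_surjective ℂ (Rel m) a
  induction a using FreeAlgebra.induction with
  | grade0 c => simpa using hscal c
  | grade1 x =>
    cases x with
    | none => exact hchi
    | some x => exact hgen x
  | mul a b ha hb => simpa using hmul _ _ ha hb
  | add a b ha hb => simpa using hadd _ _ ha hb

lemma gen_M_comm (a : Env m) : Commute (gen m .M) a := by
  induction a using env_induction with
  | hscal c => exact (Algebra.commutes c _).symm
  | hgen x =>
    have h := gen_mul_gen m .M x
    cases x <;> simp [sgn, Gen.isOdd, bracket, commute_iff_eq] at h ⊢ <;> exact h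
  | hchi => simpa [Gen.isOdd, commute_iff_eq] using (chi_mul_gen m .M).symm
  | hadd a b ha hb => exact ha.add_right hb
  | hmul a b ha hb => exact ha.mul_right hb

variable (m)

/-- The part of `S` that commutes with `P` and `G` on modules of mass `m`. -/
noncomputable def redS : Env m := gen m .S - m⁻¹ • (gen m .G * gen m .X)

/-- The part of `Q` that commutes with `P` and `G` on modules of mass `m`. -/
noncomputable def redQ : Env m := gen m .Q - m⁻¹ • (gen m .P * gen m .X)

end Env

section Hom

variable {m : ℂ} {A : Type*} [Ring A] [Algebra ℂ A]

/-- The relations that `S - m⁻¹ G X` and `Q - m⁻¹ P X` satisfy with `P`, `G` and `X`. -/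
lemma reduced_relations (hm : m ≠ 0) {P G S Q X K H : A} (p_g : P * G = G * P + m • 1)
    (s_g : S * G = G * S) (s_p : S * P = P * S + -X) (q_g : Q * G = G * Q + X)
    (q_p : Q * P = P * Q) (X_g : X * G = G * X) (X_p : X * P = P * X)
    (X_s : X * S = -(S * X) + -G) (X_q : X * Q = -(Q * X) + -P) (X_X : X * X = -(X * X) + -(m • 1))
    (q_k : Q * K = K * Q + S) (h_s : H * S = S * H + Q)
    (s_s : S * S = -(S * S) + -((2 : ℂ) • K)) (q_q : Q * Q = -(Q * Q) + -((2 : ℂ) • H)) :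
    let s := S - m⁻¹ • (G * X)
    let q := Q - m⁻¹ • (P * X)
    s * G = G * s ∧ q * G = G * q ∧ s * P = P * s ∧ q * P = P * q ∧ X * s = -(s * X) ∧
    X * q = -(q * X) ∧ X * X = -(m / 2) • 1 ∧ q * (s * s) = s * (s * q) - s ∧
    q * (q * s) = s * (q * q) - q := by
  have hK : K = -(S * S) := by linear_combination (norm := module) (1 / 2 : ℂ) • s_s
  have hH : H = -(Q * Q) := by linear_combination (norm := module) (1 / 2 : ℂ) • q_q
  have X_X' : X * X = -(m / 2) • 1 := by linear_combination (norm := module) (1 / 2 : ℂ) • X_X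
  subst hK hH
  clear s_s q_q X_X
  -- Each relation is a rewrite rule towards the order `G, P, S, Q, X`.
  have q_s_s : Q * (S * S) = S * (S * Q) - S := by
    linear_combination (norm := noncomm_ring) -q_k
  have q_q_s : Q * (Q * S) = S * (Q * Q) - Q := by
    linear_combination (norm := noncomm_ring) -h_s
  have trail {a b c : A} (h : a * b = c) (x : A) : a * (b * x) = c * x := by
    rw [← mul_assoc, h]
  intro s q
  refine ⟨?_, ?_, ?_, ?_, ?_, ?_, X_X', ?_, ?_⟩ <;>
    simp only [s, q, mul_assoc, mul_add, add_mul, mul_sub, sub_mul,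
      smul_mul_assoc, mul_smul_comm, neg_mul, mul_neg, smul_add, smul_sub, smul_neg,
      mul_one, one_mul, smul_smul, p_g, s_g, q_g, X_g, s_p, q_p, X_p, X_s, X_q, X_X',
      trail p_g, trail s_g, trail q_g, trail X_g, trail s_p, trail q_p, trail X_p,
      trail X_s, trail X_q, q_s_s, q_q_s] <;>
    match_scalars <;> field_simp <;> ring

lemma exists_decoupling_aux (hm : m ≠ 0) (f : Env m →ₐ[ℂ] A) (hM : f (gen m .M) = m • 1) :
    ∃ F : Decoupling A m, F.g = f (gen m .G) ∧ F.p = f (gen m .P) ∧ F.s = f (redS m) ∧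
      F.q = f (redQ m) ∧ F.X = f (gen m .X) ∧ F.chi = f (chi m) := by
  have rel (x y : Gen) := congrArg f (gen_mul_gen m x y)
  have crel (x : Gen) := congrArg f (chi_mul_gen m x)
  have c_c := congrArg f (chi_mul_chi m)
  simp only [sum_gen, map_add, map_mul, map_smul, map_one, hM] at rel crel c_c
  have p_g := rel .P .G
  have s_g := rel .S .G
  have s_p := rel .S .P
  have q_g := rel .Q .G
  have q_p := rel .Q .P
  have X_g := rel .X .G
  have X_p := rel .X .P
  have X_s := rel .X .S
  have X_q := rel .X .Q
  have X_X := rel .X .X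
  have q_k := rel .Q .K
  have h_s := rel .H .S
  have s_s := rel .S .S
  have q_q := rel .Q .Q
  have c_g := crel .G
  have c_p := crel .P
  have c_s := crel .S
  have c_q := crel .Q
  have c_X := crel .X
  simp only [sgn, bracket, Gen.isOdd, Pi.single_apply, reduceCtorEq, if_true, if_false,
    Int.cast_zero, Int.cast_one, Int.cast_neg, Int.cast_ofNat, zero_smul, add_zero, zero_add,
    one_smul, Pi.zero_apply, Bool.and_self, Bool.and_false, Bool.false_and, Bool.false_eq_true,
    neg_smul]
    at p_g s_g s_p q_g q_p X_g X_p X_s X_q X_X q_k h_s s_s q_q c_g c_p c_s c_q c_X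
  obtain ⟨h1, h2, h3, h4, h5, h6, h7, h8, h9⟩ := reduced_relations hm p_g s_g s_p q_g q_p X_g X_p
    X_s X_q X_X q_k h_s s_s q_q
  refine ⟨
  { g := f (gen m .G)
    p := f (gen m .P)
    s := f (redS m)
    q := f (redQ m)
    X := f (gen m .X)
    chi := f (chi m)
    p_g := p_g
    s_g := by simpa [redS] using h1
    q_g := by simpa [redQ] using h2
    X_g := X_g
    s_p := by simpa [redS] using h3
    q_p := by simpa [redQ] using h4
    X_p := X_p
    X_s := by simpa [redS] using h5
    X_q := by simpa [redQ] using h6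
    X_X := h7
    q_s_s := by simpa [redS, redQ] using h8
    q_q_s := by simpa [redS, redQ] using h9
    chi_g := c_g
    chi_p := c_p
    chi_s := by
      simp only [redS, map_sub, map_smul, map_mul, mul_sub, sub_mul, c_s, mul_smul_comm,
        smul_mul_assoc]
      rw [← mul_assoc, c_g, mul_assoc, c_X, mul_neg, mul_assoc]
      module
    chi_q := by
      simp only [redQ, map_sub, map_smul, map_mul, mul_sub, sub_mul, c_q, mul_smul_comm,
        smul_mul_assoc]
      rw [← mul_assoc, c_p, mul_assoc, c_X, mul_neg, mul_assoc]
      module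
    chi_X := c_X
    chi_chi := c_c }, rfl, rfl, rfl, rfl, rfl, rfl⟩

/-- Every representation of mass `m` comes from decoupled elements, as in `Decoupling.lift`. -/
lemma exists_decoupling (hm : m ≠ 0) (f : Env m →ₐ[ℂ] A) (hM : f (gen m .M) = m • 1) :
    ∃ F : Decoupling A m, (∀ x, f (gen m x) = F.gen x) ∧ f (chi m) = F.chi ∧
      f (redS m) = F.s ∧ f (redQ m) = F.q := by
  obtain ⟨F, hg, hp, hs, hq, hX, hc⟩ := exists_decoupling_aux hm f hM
  refine ⟨F, fun x => ?_, hc.symm, hs.symm, hq.symm⟩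
  have hQ : f (gen m .Q) = F.gen .Q := by simp [Decoupling.gen, hp, hq, hX, redQ]
  have hS : f (gen m .S) = F.gen .S := by simp [Decoupling.gen, hg, hs, hX, redS]
  have key (x y : Gen) : ∑ z, (bracket x y z : ℂ) • f (gen m z) =
      f (gen m x) * f (gen m y) -
      (sgn x y : ℂ) • (f (gen m y) * f (gen m x)) := by
    have := congrArg f (gen_mul_gen m x y)
    simp only [map_add, map_mul, map_smul, map_sum] at this
    rw [this, add_sub_cancel_left]
  have hodd {x y z : Gen} {n : ℂ} (hn : n ≠ 0)
      (hx : f (gen m x) = F.gen x) (hy : f (gen m y) = F.gen y)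
      (hb : ∀ w, (bracket x y w : ℂ) = if w = z then n else 0) :
      f (gen m z) = F.gen z := by
    have h1 := key x y
    rw [hx, hy, F.gen_bracket hm] at h1
    simpa [hb, hn] using h1
  have hb (x y z : Gen) (n : ℤ) (h : ∀ w, bracket x y w = if w = z then n else 0) (w : Gen) :
      (bracket x y w : ℂ) = if w = z then (n : ℂ) else 0 := by
    rw [h]; split_ifs <;> simp
  cases x with
  | Q => exact hQ
  | S => exact hS
  | X => exact hX.symm
  | P => exact hp.symm
  | G => exact hg.symm
  | M => exact hM
  | H => exact hodd (by norm_num) hQ hQ (hb .Q .Q .H (-2) (by decide))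
  | K => exact hodd (by norm_num) hS hS (hb .S .S .K (-2) (by decide))
  | D => exact hodd (by norm_num) hQ hS (hb .Q .S .D (-1) (by decide))

end Hom

section Module

variable {m : ℂ} {V : Type*} [AddCommGroup V] [Module (Env m) V]

lemma IsLowestWeightModule.mass_smul {d : ℝ} {v : V} (h : IsLowestWeightModule d m V v) (x : V) :
    gen m .M • x = scal m m • x := by
  have hx : x ∈ Submodule.span (Env m) {v} := h.span_eq_top ▸ Submodule.mem_top
  obtain ⟨a, rfl⟩ := Submodule.mem_span_singleton.mp hx
  rw [← mul_smul, (gen_M_comm a).eq, mul_smul, h.lowest.M_smul, ← mul_smul, ← mul_smul,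
    Algebra.commutes]

variable [Module ℂ V] [IsScalarTower ℂ (Env m) V]

lemma scal_smul (c : ℂ) (x : V) : scal m c • x = c • x := algebraMap_smul _ _ _

/-- The mass operator acts on `V` by `m`. -/
def HasMass (m : ℂ) (V : Type*) [AddCommGroup V] [Module ℂ V] [Module (Env m) V] : Prop :=
  ∀ x : V, gen m .M • x = m • x

lemma IsLowestWeightModule.hasMass {d : ℝ} {v : V} (h : IsLowestWeightModule d m V v) :
    HasMass m V := fun x => by
  rw [h.mass_smul, scal_smul]

/-- Taking traces in `[P, G] = m` excludes nonzero finite-dimensional modules of mass `m ≠ 0`. -/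
lemma HasMass.not_finiteDimensional [NeZero m] [Nontrivial V] (h : HasMass m V) :
    ¬ FiniteDimensional ℂ V := by
  intro _
  let ρ := Algebra.lsmul ℂ ℂ V (A := Env m)
  have h1 : ρ (gen m .P) * ρ (gen m .G) - ρ (gen m .G) * ρ (gen m .P) = m • 1 := by
    ext x
    have := congrArg (· • x) (gen_mul_gen m .P .G)
    simp only [sgn, Gen.isOdd, bracket, sum_gen] at this
    simp only [add_smul, mul_smul] at this
    simpa [h x, sub_eq_iff_eq_add', mul_smul, ρ] using this
  have h2 := congrArg (LinearMap.trace ℂ V) h1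
  rw [map_sub, LinearMap.trace_mul_comm, sub_self, map_smul, LinearMap.trace_one] at h2
  have : Module.finrank ℂ V ≠ 0 := Module.finrank_pos.ne'
  simp [NeZero.ne m, this] at h2

end Module

/-! ### Action on the monomials `gᵃ sᵏ χ^ε v` -/

namespace Decoupling

variable {m : ℂ} {V : Type*} [AddCommGroup V] [Module ℂ V] (F : Decoupling (Module.End ℂ V) m)

/-- The monomial `gᵃ sᵏ χ^ε v`. -/
def vec (v : V) (a k : ℕ) (e : Bool) : V :=
  (F.g ^ a) ((F.s ^ k) (if e then F.chi v else v))

variable (v : V) (a k : ℕ) (e : Bool)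

lemma g_vec : F.g (F.vec v a k e) = F.vec v (a + 1) k e := by
  rw [vec, vec, pow_succ', Module.End.mul_apply]

lemma s_vec : F.s (F.vec v a k e) = F.vec v a (k + 1) e := by
  have hc : Commute F.s (F.g ^ a) := Commute.pow_right F.s_g a
  rw [vec, vec, pow_succ']
  exact LinearMap.congr_fun hc.eq _

/-- An operator that commutes with `g` and anticommutes with `s` moves past `gᵃ sᵏ` with the sign
`(-1)ᵏ`. -/
lemma odd_vec {c : Module.End ℂ V} (hg : c * F.g = F.g * c) (hs : c * F.s = -(F.s * c)) :
    c (F.vec v a k e) =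
      ((-1) ^ k : ℂ) • (F.g ^ a) ((F.s ^ k) (c (if e then F.chi v else v))) := by
  have hc : Commute c (F.g ^ a) := Commute.pow_right hg a
  have h : c * F.s ^ k = ((-1) ^ k : ℂ) • (F.s ^ k * c) := by
    induction k with
    | zero => simp
    | succ k ih =>
      rw [pow_succ, ← mul_assoc, ih, smul_mul_assoc, mul_assoc, hs, pow_succ, mul_neg, ← mul_assoc]
      module
  have h1 (x : V) : c ((F.s ^ k) x) = ((-1) ^ k : ℂ) • (F.s ^ k) (c x) := LinearMap.congr_fun h x
  have h2 (x : V) : c ((F.g ^ a) x) = (F.g ^ a) (c x) := LinearMap.congr_fun hc.eq x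
  rw [vec, h2, h1, map_smul]

lemma chi_vec : F.chi (F.vec v a k e) =
    ((-1) ^ k * (if e then m / 2 else 1) : ℂ) • F.vec v a k (!e) := by
  have hcc : F.chi (F.chi v) = (m / 2) • v := LinearMap.congr_fun F.chi_chi v
  rw [F.odd_vec v a k e F.chi_g F.chi_s]
  cases e <;> simp [vec, hcc, smul_smul]

/-- `v` is a lowest weight vector in terms of decoupled operators; the weight of `q s v` is
`d + 1/2` because the Heisenberg pair contributes `1/2` to the weight of `D`. -/
structure IsVacuum (d : ℝ) : Prop where
  p_eq : F.p v = 0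
  q_eq : F.q v = 0
  X_eq : F.X v = F.chi v
  q_s_eq : F.q (F.s v) = ((d : ℂ) + 1 / 2) • v

variable {F v} {d : ℝ} (h : F.IsVacuum v d)
include h

lemma IsVacuum.X_vec : F.X (F.vec v a k e) =
    ((-1) ^ k * (if e then -(m / 2) else 1) : ℂ) • F.vec v a k (!e) := by
  have hXc : F.X (F.chi v) = -(m / 2) • v := by
    have h1 : F.chi (F.X v) = -(F.X (F.chi v)) := LinearMap.congr_fun F.chi_X v
    have h2 : F.chi (F.chi v) = (m / 2) • v := LinearMap.congr_fun F.chi_chi v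
    rw [h.X_eq, h2] at h1
    rw [neg_smul, h1, neg_neg]
  rw [F.odd_vec v a k e F.X_g F.X_s]
  cases e <;> simp [vec, hXc, h.X_eq, smul_smul]

lemma IsVacuum.p_vec : F.p (F.vec v a k e) = (m * a) • F.vec v (a - 1) k e := by
  have h0 : F.p (F.vec v 0 k e) = 0 := by
    have h1 : Commute F.p (F.s ^ k) := Commute.pow_right F.s_p.symm k
    have h2 (x : V) : F.p ((F.s ^ k) x) = (F.s ^ k) (F.p x) := LinearMap.congr_fun h1.eq x
    have h3 : F.p (F.chi v) = 0 := by
      have : F.chi (F.p v) = F.p (F.chi v) := LinearMap.congr_fun F.chi_p v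
      rw [← this, h.p_eq, map_zero]
    cases e <;> simp [vec, h2, h3, h.p_eq]
  induction a with
  | zero => simpa using h0
  | succ a ih =>
    have h1 (x : V) : F.p (F.g x) = F.g (F.p x) + m • x := LinearMap.congr_fun F.p_g x
    rw [← g_vec, h1, ih, map_smul, g_vec]
    cases a with
    | zero => simp
    | succ a =>
      push_cast
      module

end Decoupling

/-- The coefficients satisfy the recursion that `q s² = s² q - s` imposes. -/
lemma lowerCoeff_add_two (d : ℝ) (k : ℤ) : lowerCoeff d (k + 2) = lowerCoeff d k - 1 := by
  rw [lowerCoeff, lowerCoeff, zpow_add₀ (by norm_num)]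
  push_cast
  ring

lemma lowerCoeff_zero (d : ℝ) : lowerCoeff d 0 = 0 := by simp [lowerCoeff]

lemma lowerCoeff_one (d : ℝ) : lowerCoeff d 1 = d + 1 / 2 := by
  rw [lowerCoeff]
  norm_num
  ring

lemma lowerCoeff_two_mul (d : ℝ) (j : ℤ) : lowerCoeff d (2 * j) = -j := by
  rw [lowerCoeff, (even_two_mul j).neg_one_zpow]
  push_cast
  ring

lemma lowerCoeff_two_mul_add_one (d : ℝ) (j : ℤ) :
    lowerCoeff d (2 * j + 1) = d + 1 / 2 - j := by
  rw [lowerCoeff, (odd_two_mul_add_one j).neg_one_zpow]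
  push_cast
  ring

namespace Decoupling

variable {m : ℂ} {V : Type*} [AddCommGroup V] [Module ℂ V] {F : Decoupling (Module.End ℂ V) m}
  {v : V} {d : ℝ} (h : F.IsVacuum v d) (a k : ℕ) (e : Bool)
include h

lemma IsVacuum.q_vec : F.q (F.vec v a k e) = lowerCoeff d k • F.vec v a (k - 1) e := by
  have hg : Commute F.q (F.g ^ a) := Commute.pow_right F.q_g a
  have hg' (x : V) : F.q ((F.g ^ a) x) = (F.g ^ a) (F.q x) := LinearMap.congr_fun hg.eq x
  have hqss (x : V) : F.q (F.s (F.s x)) = F.s (F.s (F.q x)) - F.s x :=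
    LinearMap.congr_fun F.q_s_s x
  have hqc (x : V) : F.q (F.chi x) = -F.chi (F.q x) := by
    rw [show F.chi (F.q x) = -F.q (F.chi x) from LinearMap.congr_fun F.chi_q x, neg_neg]
  have hsc (x : V) : F.s (F.chi x) = -F.chi (F.s x) := by
    rw [show F.chi (F.s x) = -F.s (F.chi x) from LinearMap.congr_fun F.chi_s x, neg_neg]
  set w := if e then F.chi v else v with hw
  have h0 : F.q w = 0 := by cases e <;> simp [w, hqc, h.q_eq]
  have h1 : F.q (F.s w) = ((d : ℂ) + 1 / 2) • w := by
    cases e <;> simp [w, hqc, hsc, h.q_s_eq]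
  have key (k : ℕ) : F.q ((F.s ^ k) w) = lowerCoeff d k • (F.s ^ (k - 1)) w := by
    induction k using Nat.twoStepInduction with
    | zero => simp [h0, lowerCoeff_zero]
    | one => simp [h1, lowerCoeff_one]
    | more k ih _ =>
      rw [pow_succ', pow_succ', Module.End.mul_apply, Module.End.mul_apply, hqss, ih, map_smul,
        map_smul]
      push_cast
      rw [lowerCoeff_add_two]
      cases k with
      | zero => simp [lowerCoeff_zero]
      | succ k =>
        simp only [Nat.add_sub_cancel, pow_succ', Module.End.mul_apply]
        module
  rw [vec, hg', key, map_smul]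
  rfl

end Decoupling

section Module

variable {m : ℂ} {V : Type*} [AddCommGroup V] [Module (Env m) V] [Module ℂ V]

/-- The decoupled operators on a module are those through which the enveloping algebra acts. -/
structure Decoupling.IsCompatible (F : Decoupling (Module.End ℂ V) m) : Prop where
  gen_smul (x : Gen) (v : V) : SuperSchrodinger.gen m x • v = F.gen x v
  chi_smul (v : V) : SuperSchrodinger.chi m • v = F.chi v
  redS_smul (v : V) : redS m • v = F.s v
  redQ_smul (v : V) : redQ m • v = F.q v

lemma HasMass.exists_isCompatible [NeZero m] [IsScalarTower ℂ (Env m) V] (h : HasMass m V) :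
    ∃ F : Decoupling (Module.End ℂ V) m, F.IsCompatible := by
  obtain ⟨F, h1, h2, h3, h4⟩ := exists_decoupling (NeZero.ne m)
    (Algebra.lsmul ℂ ℂ V (A := Env m)) (by ext x; simpa using h x)
  exact ⟨F, fun x => LinearMap.congr_fun (h1 x), LinearMap.congr_fun h2, LinearMap.congr_fun h3,
    LinearMap.congr_fun h4⟩

namespace Decoupling.IsCompatible

variable {F : Decoupling (Module.End ℂ V) m} (hF : F.IsCompatible)
include hF

lemma G_smul (x : V) : SuperSchrodinger.gen m .G • x = F.g x := hF.gen_smul .G x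
lemma P_smul (x : V) : SuperSchrodinger.gen m .P • x = F.p x := hF.gen_smul .P x
lemma X_smul (x : V) : SuperSchrodinger.gen m .X • x = F.X x := hF.gen_smul .X x

variable [IsScalarTower ℂ (Env m) V]

lemma isVacuum [NeZero m] {d : ℝ} {v : V} (hv : IsLowestWeightVector d m v) : F.IsVacuum v d := by
  have hm := NeZero.ne m
  have hp : F.p v = 0 := by rw [← hF.P_smul]; exact hv.neg_smul .P (by decide)
  have hX : F.X v = F.chi v := by rw [← hF.X_smul, ← hF.chi_smul]; exact hv.X_smul
  have hq : F.q v = 0 := by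
    have h1 := hv.neg_smul .Q (by decide)
    have h2 : F.p (F.X v) = 0 := by
      rw [← show F.X (F.p v) = F.p (F.X v) from LinearMap.congr_fun F.X_p v, hp, map_zero]
    rw [hF.gen_smul] at h1
    simpa [gen, h2] using h1
  refine ⟨hp, hq, hX, ?_⟩
  have h1 := hv.D_smul
  have h2 : F.p (F.g v) = F.g (F.p v) + m • v := LinearMap.congr_fun F.p_g v
  rw [hF.gen_smul, scal_smul] at h1
  simp only [gen, LinearMap.add_apply, LinearMap.neg_apply, LinearMap.smul_apply,
    Module.End.mul_apply, hq, hp, map_zero, add_zero, h2, zero_add] at h1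
  have h3 : (2 * m)⁻¹ • m • v = (1 / 2 : ℂ) • v := by
    rw [smul_smul]; congr 1; field_simp
  rw [h3] at h1
  linear_combination (norm := module) -h1

/-- A complex subspace stable under the decoupled operators is stable under the enveloping
algebra. -/
lemma smul_mem (W : Submodule ℂ V) (hg : ∀ x ∈ W, F.g x ∈ W) (hp : ∀ x ∈ W, F.p x ∈ W)
    (hX : ∀ x ∈ W, F.X x ∈ W) (hc : ∀ x ∈ W, F.chi x ∈ W) (hs : ∀ x ∈ W, F.s x ∈ W)
    (hq : ∀ x ∈ W, F.q x ∈ W) (a : Env m) {x : V} (hx : x ∈ W) : a • x ∈ W := by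
  induction a using env_induction generalizing x with
  | hscal c => rw [scal_smul]; exact W.smul_mem c hx
  | hgen y =>
    rw [hF.gen_smul]
    cases y with
    | P => exact hp x hx
    | G => exact hg x hx
    | X => exact hX x hx
    | M => exact W.smul_mem m hx
    | Q => exact W.add_mem (hq x hx) (W.smul_mem _ (hp _ (hX x hx)))
    | S => exact W.add_mem (hs x hx) (W.smul_mem _ (hg _ (hX x hx)))
    | H => exact W.add_mem (W.neg_mem (hq _ (hq x hx))) (W.smul_mem _ (hp _ (hp x hx)))
    | K => exact W.add_mem (W.neg_mem (hs _ (hs x hx))) (W.smul_mem _ (hg _ (hg x hx)))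
    | D =>
      exact W.add_mem (W.neg_mem (W.add_mem (hq _ (hs x hx)) (hs _ (hq x hx))))
        (W.smul_mem _ (W.add_mem (hp _ (hg x hx)) (hg _ (hp x hx))))
  | hchi => rw [hF.chi_smul]; exact hc x hx
  | hadd a b ha hb => rw [add_smul]; exact W.add_mem (ha hx) (hb hx)
  | hmul a b ha hb => rw [mul_smul]; exact ha (hb hx)

/-- The monomials span the submodule generated by a vacuum. -/
lemma span_vec [NeZero m] {d : ℝ} {v : V} (hv : IsLowestWeightModule d m V v) :
    ⊤ ≤ Submodule.span ℂ (Set.range fun i : ℕ × ℕ × Bool => F.vec v i.1 i.2.1 i.2.2) := by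
  have hvac := hF.isVacuum hv.lowest
  set W := Submodule.span ℂ (Set.range fun i : ℕ × ℕ × Bool => F.vec v i.1 i.2.1 i.2.2)
  have hmem (a k e) : F.vec v a k e ∈ W := Submodule.subset_span ⟨(a, k, e), rfl⟩
  have hstab (f : Module.End ℂ V) (hf : ∀ a k e, f (F.vec v a k e) ∈ W) : ∀ x ∈ W, f x ∈ W := by
    intro x hx
    have : W ≤ W.comap f := Submodule.span_le.mpr (by rintro _ ⟨i, rfl⟩; exact hf _ _ _)
    exact this hx
  intro x _
  have hx : x ∈ Submodule.span (Env m) {v} := hv.span_eq_top ▸ Submodule.mem_top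
  obtain ⟨a, rfl⟩ := Submodule.mem_span_singleton.mp hx
  refine hF.smul_mem W (hstab _ fun a k e => ?_) (hstab _ fun a k e => ?_)
    (hstab _ fun a k e => ?_) (hstab _ fun a k e => ?_) (hstab _ fun a k e => ?_)
    (hstab _ fun a k e => ?_) a (hmem 0 0 false)
  · rw [g_vec]; exact hmem _ _ _
  · rw [hvac.p_vec]; exact W.smul_mem _ (hmem _ _ _)
  · rw [hvac.X_vec]; exact W.smul_mem _ (hmem _ _ _)
  · rw [chi_vec]; exact W.smul_mem _ (hmem _ _ _)
  · rw [s_vec]; exact hmem _ _ _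
  · rw [hvac.q_vec]; exact W.smul_mem _ (hmem _ _ _)

omit [IsScalarTower ℂ (Env m) V] in
/-- Homomorphisms of modules map monomials to monomials. -/
lemma map_vec {V' : Type*} [AddCommGroup V'] [Module (Env m) V'] [Module ℂ V']
    [IsScalarTower ℂ (Env m) V'] {F' : Decoupling (Module.End ℂ V') m} (hF' : F'.IsCompatible)
    (f : V →ₗ[Env m] V') (v : V) (a k : ℕ) (e : Bool) :
    f (F.vec v a k e) = F'.vec (f v) a k e := by
  induction a with
  | succ a ih => rw [← g_vec, ← g_vec, ← hF.G_smul, map_smul, ih, hF'.G_smul]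
  | zero =>
    induction k with
    | succ k ih => rw [← s_vec, ← s_vec, ← hF.redS_smul, map_smul, ih, hF'.redS_smul]
    | zero => cases e <;> simp [vec, ← hF.chi_smul, ← hF'.chi_smul]

end Decoupling.IsCompatible

end Module

/-! ### The basis of the Verma module -/

section Fock

variable (d : ℝ) (m : ℂ)

lemma delta_apply (a k : ℤ) (e : Bool) (x : ℤ × ℤ × Bool) :
    delta d m a k e x = if x = (a, k, e) then 1 else 0 := rfl

lemma fock_g_delta (a k : ℤ) (e : Bool) :
    (fockDecoupling d m).g (delta d m a k e) = delta d m (a + 1) k e := by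
  funext ⟨a', k', e'⟩
  simp [fockDecoupling, weightedShift_apply, delta_apply, ← sub_eq_add_neg, sub_eq_iff_eq_add]

lemma fock_s_delta (a k : ℤ) (e : Bool) :
    (fockDecoupling d m).s (delta d m a k e) = delta d m a (k + 1) e := by
  funext ⟨a', k', e'⟩
  simp [fockDecoupling, weightedShift_apply, delta_apply, ← sub_eq_add_neg, sub_eq_iff_eq_add]

lemma fock_chi_delta_zero :
    (fockDecoupling d m).chi (delta d m 0 0 false) = delta d m 0 0 true := by
  funext ⟨a', k', e'⟩
  by_cases h : k' = 0 <;> cases e' <;>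
    simp [fockDecoupling, weightedShift_apply, delta_apply, h]

lemma fock_X_delta_zero :
    (fockDecoupling d m).X (delta d m 0 0 false) = delta d m 0 0 true := by
  funext ⟨a', k', e'⟩
  by_cases h : k' = 0 <;> cases e' <;>
    simp [fockDecoupling, weightedShift_apply, delta_apply, h]

lemma fock_p_delta_zero (e : Bool) : (fockDecoupling d m).p (delta d m 0 0 e) = 0 := by
  funext ⟨a', k', e'⟩
  change _ = (0 : ℂ)
  simp only [fockDecoupling, weightedShift_apply, delta_apply]
  by_cases h : a' + 1 = 0
  · simp [show (a' : ℂ) + 1 = 0 by exact_mod_cast h]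
  · simp [h]

lemma fock_q_delta_zero (a : ℤ) (e : Bool) : (fockDecoupling d m).q (delta d m a 0 e) = 0 := by
  funext ⟨a', k', e'⟩
  change _ = (0 : ℂ)
  simp only [fockDecoupling, weightedShift_apply, delta_apply]
  by_cases h : k' + 1 = 0 <;> simp [h, lowerCoeff_zero]

lemma fock_q_delta_one (a : ℤ) (e : Bool) :
    (fockDecoupling d m).q (delta d m a 1 e) = ((d : ℂ) + 1 / 2) • delta d m a 0 e := by
  funext ⟨a', k', e'⟩
  rw [fock_smul_apply]
  simp only [fockDecoupling, weightedShift_apply, delta_apply]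
  by_cases h : k' = 0
  · simp [h, lowerCoeff_one]
  · simp [h]

lemma fock_vec (a k : ℕ) (e : Bool) :
    (fockDecoupling d m).vec (delta d m 0 0 false) a k e = delta d m a k e := by
  induction a with
  | succ a ih => rw [← Decoupling.g_vec, ih, fock_g_delta]; push_cast; rfl
  | zero =>
    induction k with
    | succ k ih => rw [← Decoupling.s_vec, ih, fock_s_delta]; push_cast; rfl
    | zero => cases e <;> simp [Decoupling.vec, fock_chi_delta_zero]

lemma linearIndependent_delta : LinearIndependent ℂ
    fun i : ℕ × ℕ × Bool => delta d m i.1 i.2.1 i.2.2 := by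
  rw [linearIndependent_iff']
  intro s c hc i hi
  have key : ∀ t : Finset (ℕ × ℕ × Bool),
      (∑ j ∈ t, c j • delta d m j.1 j.2.1 j.2.2) ((i.1 : ℤ), (i.2.1 : ℤ), i.2.2) =
        ∑ j ∈ t, c j * if i = j then 1 else 0 := by
    intro t
    induction t using Finset.induction_on with
    | empty => rfl
    | insert j t hj ih =>
      rw [Finset.sum_insert hj, Finset.sum_insert hj, fock_add_apply, ih, fock_smul_apply,
        delta_apply]
      simp [Prod.ext_iff]
  have h := key s
  rw [hc] at h
  change (0 : ℂ) = _ at h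
  simpa [hi, eq_comm] using h.symm

variable [NeZero m]

lemma fock_isCompatible : (fockDecoupling d m).IsCompatible where
  gen_smul x f := by rw [fock_smul, Decoupling.lift_gen]
  chi_smul f := by rw [fock_smul, Decoupling.lift_chi]
  redS_smul f := by
    simp [fock_smul, redS, Decoupling.lift_gen, Decoupling.gen]
  redQ_smul f := by
    simp [fock_smul, redQ, Decoupling.lift_gen, Decoupling.gen]

lemma fock_isLowestWeightVector : IsLowestWeightVector d m (delta d m 0 0 false) := by
  have hm := NeZero.ne m
  have hF := fock_isCompatible d m
  set F := fockDecoupling d m with hFdef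
  set v := delta d m 0 0 false with hv
  have hp : F.p v = 0 := fock_p_delta_zero d m false
  have hp' : F.p (F.X v) = 0 := by
    rw [hFdef, hv, fock_X_delta_zero]; exact fock_p_delta_zero d m true
  have hq : F.q v = 0 := fock_q_delta_zero d m 0 false
  refine ⟨fun h => ?_, fun x hx => ?_, ?_, ?_, ?_⟩
  · have := congrFun h (0, 0, false)
    change (if _ then (1 : ℂ) else 0) = 0 at this
    simp at this
  · rw [hF.gen_smul]
    cases x <;> simp [Gen.deg] at hx <;> simp [Decoupling.gen, hp, hq, hp']
  · have h1 : F.p (F.g v) = F.g (F.p v) + m • v := LinearMap.congr_fun F.p_g v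
    have h2 : F.q (F.s v) = ((d : ℂ) + 1 / 2) • v := by
      rw [hv, hFdef, fock_s_delta]; exact fock_q_delta_one d m 0 false
    rw [hF.gen_smul, scal_smul]
    simp only [Decoupling.gen, LinearMap.add_apply, LinearMap.neg_apply, LinearMap.smul_apply,
      Module.End.mul_apply, h1, h2, hp, hq, map_zero, zero_add, add_zero]
    match_scalars
    field_simp
    ring
  · rw [hF.gen_smul, scal_smul]; rfl
  · rw [hF.X_smul, hF.chi_smul, hFdef, hv, fock_X_delta_zero, fock_chi_delta_zero]

end Fock

section Verma

variable {d : ℝ} {m : ℂ}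

/-- The universal property of the Verma module. -/
lemma exists_verma_hom {V : Type*} [AddCommGroup V] [Module (Env m) V] {v : V}
    (hv : IsLowestWeightVector d m v) : ∃ f : Verma d m →ₗ[Env m] V, f (vac d m) = v := by
  refine ⟨(vermaIdeal d m).liftQ (LinearMap.toSpanSingleton (Env m) V v) ?_, ?_⟩
  · refine Submodule.span_le.mpr ?_
    rintro a (⟨x, hx, rfl⟩ | rfl | rfl | rfl)
    · simpa using hv.neg_smul x hx
    · exact (sub_smul _ _ v).trans (sub_eq_zero.mpr hv.D_smul)
    · exact (sub_smul _ _ v).trans (sub_eq_zero.mpr hv.M_smul)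
    · exact (sub_smul _ _ v).trans (sub_eq_zero.mpr hv.X_smul)
  · exact ((vermaIdeal d m).liftQ_apply _ 1).trans (one_smul _ v)

lemma smul_vac_eq (a : Env m) : a • vac d m = (vermaIdeal d m).mkQ a := by
  rw [vac, ← map_smul, smul_eq_mul, mul_one]

lemma smul_vac_eq_zero {a : Env m} (ha : a ∈ vermaIdeal d m) : a • vac d m = 0 := by
  rw [smul_vac_eq]
  exact (Submodule.Quotient.mk_eq_zero _).mpr ha

lemma smul_vac_eq_smul_vac {a b : Env m} (h : a - b ∈ vermaIdeal d m) :
    a • vac d m = b • vac d m := by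
  exact sub_eq_zero.mp ((sub_smul a b (vac d m)).symm.trans (smul_vac_eq_zero h))

variable (d m) [NeZero m]

lemma verma_isLowestWeightModule : IsLowestWeightModule d m (Verma d m) (vac d m) where
  lowest :=
    { ne_zero := fun h => by
        obtain ⟨f, hf⟩ := exists_verma_hom (fock_isLowestWeightVector d m)
        exact (fock_isLowestWeightVector d m).ne_zero (by rw [← hf, h, map_zero])
      neg_smul := fun x hx => smul_vac_eq_zero (Submodule.subset_span (Or.inl ⟨x, hx, rfl⟩))
      D_smul := smul_vac_eq_smul_vac (Submodule.subset_span (by simp))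
      M_smul := smul_vac_eq_smul_vac (Submodule.subset_span (by simp))
      X_smul := smul_vac_eq_smul_vac (Submodule.subset_span (by simp)) }
  span_eq_top := by
    rw [eq_top_iff]
    rintro x -
    obtain ⟨a, rfl⟩ := (vermaIdeal d m).mkQ_surjective x
    exact Submodule.mem_span_singleton.mpr ⟨a, smul_vac_eq a⟩

lemma verma_exists_isCompatible :
    ∃ F : Decoupling (Module.End ℂ (Verma d m)) m, F.IsCompatible :=
  (verma_isLowestWeightModule d m).hasMass.exists_isCompatible

/-- The decoupled operators on the Verma module. -/
noncomputable def vermaDecoupling : Decoupling (Module.End ℂ (Verma d m)) m :=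
  (verma_exists_isCompatible d m).choose

lemma verma_isCompatible : (vermaDecoupling d m).IsCompatible :=
  (verma_exists_isCompatible d m).choose_spec

lemma verma_isVacuum : (vermaDecoupling d m).IsVacuum (vac d m) d :=
  (verma_isCompatible d m).isVacuum (verma_isLowestWeightModule d m).lowest

lemma linearIndependent_verma_vec : LinearIndependent ℂ fun i : ℕ × ℕ × Bool =>
    (vermaDecoupling d m).vec (vac d m) i.1 i.2.1 i.2.2 := by
  obtain ⟨f, hf⟩ := exists_verma_hom (fock_isLowestWeightVector d m)
  refine LinearIndependent.of_comp (f.restrictScalars ℂ) ?_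
  convert linearIndependent_delta d m with i
  change f _ = _
  rw [(verma_isCompatible d m).map_vec (fock_isCompatible d m), hf, fock_vec]

/-- The monomials `Gᵃ sᵏ χ^ε v₀` as a basis of the Verma module. -/
noncomputable def vermaBasis : Module.Basis (ℕ × ℕ × Bool) ℂ (Verma d m) :=
  Module.Basis.mk (linearIndependent_verma_vec d m)
    ((verma_isCompatible d m).span_vec (verma_isLowestWeightModule d m))

lemma vermaBasis_apply (a k : ℕ) (e : Bool) :
    vermaBasis d m (a, k, e) = (vermaDecoupling d m).vec (vac d m) a k e := by
  simp [vermaBasis]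

lemma vermaBasis_zero : vermaBasis d m (0, 0, false) = vac d m := by
  simp [vermaBasis_apply, Decoupling.vec]

end Verma

/-! ### Submodules of the Verma module -/

/-- A subspace contains every basis vector that occurs in one of its elements, provided that it is
stable under enough diagonal operators to separate the basis vectors. -/
lemma basis_mem_of_diagonal {ι V : Type*} [AddCommGroup V] [Module ℂ V] (b : Module.Basis ι ℂ V)
    (N : Submodule ℂ V)
    (hsep : ∀ i j, i ≠ j → ∃ (T : Module.End ℂ V) (μ : ι → ℂ), (∀ l, T (b l) = μ l • b l) ∧
      μ i ≠ μ j ∧ ∀ x ∈ N, T x ∈ N)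
    {x : V} (hx : x ∈ N) {i : ι} (hi : b.repr x i ≠ 0) : b i ∈ N := by
  classical
  induction hs : (b.repr x).support.card using Nat.strong_induction_on generalizing x with
  | _ n ih =>
  by_cases h : ∃ j, j ≠ i ∧ b.repr x j ≠ 0
  · obtain ⟨j, hji, hj⟩ := h
    obtain ⟨T, μ, hT, hμ, hTN⟩ := hsep i j hji.symm
    have hrepr (y : V) (l : ι) : b.repr (T y) l = μ l * b.repr y l := by
      have : b.coord l ∘ₗ T = μ l • b.coord l := b.ext fun l' => by
        by_cases hl : l' = l <;> simp [hT, hl]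
      exact LinearMap.congr_fun this y
    -- `T - μ j` removes the coordinate `j` and only rescales the others.
    have hy (l : ι) : b.repr (T x - μ j • x) l = (μ l - μ j) * b.repr x l := by
      simp [hrepr, sub_mul]
    refine ih _ ?_ (N.sub_mem (hTN x hx) (N.smul_mem (μ j) hx)) ?_ rfl
    · rw [← hs]
      refine Finset.card_lt_card ⟨fun l hl => ?_, fun hle => ?_⟩
      · rw [Finsupp.mem_support_iff, hy] at hl
        exact Finsupp.mem_support_iff.mpr (right_ne_zero_of_mul hl)
      · have := hle (Finsupp.mem_support_iff.mpr hj)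
        rw [Finsupp.mem_support_iff, hy, sub_self, zero_mul] at this
        exact this rfl
    · rw [hy]
      exact mul_ne_zero (sub_ne_zero.mpr hμ) hi
  · push Not at h
    have hxi : x = b.repr x i • b i := by
      refine b.repr.injective (Finsupp.ext fun l => ?_)
      by_cases hl : l = i
      · simp [hl]
      · simp [h l hl, Finsupp.single_eq_of_ne hl]
    rw [hxi] at hx
    exact (N.smul_mem_iff hi).mp hx

/-- The eigenvalues of `q s + s q` on the powers of `s` are pairwise distinct, whereas
`lowerCoeff d` itself can repeat values. -/
lemma lowerCoeff_add_lowerCoeff (d : ℝ) (k : ℤ) :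
    lowerCoeff d k + lowerCoeff d (k + 1) = d + 1 / 2 - k := by
  rw [lowerCoeff, lowerCoeff, zpow_add₀ (by norm_num)]
  push_cast
  ring

namespace Decoupling

variable {m : ℂ} {V : Type*} [AddCommGroup V] [Module ℂ V] {F : Decoupling (Module.End ℂ V) m}
  {v : V} {d : ℝ}

lemma IsVacuum.q_s_add_s_q_vec (h : F.IsVacuum v d) (a k : ℕ) (e : Bool) :
    F.q (F.s (F.vec v a k e)) + F.s (F.q (F.vec v a k e)) =
      ((d : ℂ) + 1 / 2 - k) • F.vec v a k e := by
  have hc := lowerCoeff_add_lowerCoeff d k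
  rw [s_vec, h.q_vec, h.q_vec, map_smul, s_vec]
  push_cast at hc ⊢
  rw [← hc]
  cases k with
  | zero => simp [lowerCoeff_zero]
  | succ k =>
    simp only [Nat.add_sub_cancel]
    module

lemma IsVacuum.g_p_vec (h : F.IsVacuum v d) (a k : ℕ) (e : Bool) :
    F.g (F.p (F.vec v a k e)) = (m * a) • F.vec v a k e := by
  rw [h.p_vec, map_smul, g_vec]
  cases a <;> simp

lemma IsVacuum.X_chi_vec (h : F.IsVacuum v d) (a k : ℕ) (e : Bool) :
    F.X (F.chi (F.vec v a k e)) = (if e then m / 2 else -(m / 2)) • F.vec v a k e := by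
  have hk : ((-1 : ℂ) ^ k) * (-1) ^ k = 1 := by rw [← mul_pow]; simp
  rw [chi_vec, map_smul, h.X_vec, smul_smul, Bool.not_not]
  congr 1
  cases e <;> simp <;> linear_combination (exp := 1) (m / 2) * hk

lemma IsVacuum.D_vec (h : F.IsVacuum v d) (hm : m ≠ 0) (a k : ℕ) (e : Bool) :
    F.gen .D (F.vec v a k e) = ((a : ℂ) + k - d) • F.vec v a k e := by
  have h1 (x : V) : F.p (F.g x) = F.g (F.p x) + m • x := LinearMap.congr_fun F.p_g x
  simp only [gen, LinearMap.add_apply, LinearMap.neg_apply, LinearMap.smul_apply,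
    Module.End.mul_apply, h1, h.q_s_add_s_q_vec, h.g_p_vec]
  match_scalars
  field_simp
  ring

/-- A zero of the lowering coefficients makes `sᵏ χ^ε v` singular. -/
lemma IsVacuum.gen_vec_eq_zero (h : F.IsVacuum v d) {k : ℕ} (hk : lowerCoeff d k = 0) (e : Bool)
    {x : Gen} (hx : x.deg < 0) : F.gen x (F.vec v 0 k e) = 0 := by
  have hp (k : ℕ) (e : Bool) : F.p (F.vec v 0 k e) = 0 := by simp [h.p_vec]
  have hq : F.q (F.vec v 0 k e) = 0 := by simp [h.q_vec, hk]
  have hpX : F.p (F.X (F.vec v 0 k e)) = 0 := by rw [h.X_vec, map_smul, hp, smul_zero]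
  cases x <;> simp [Gen.deg] at hx <;> simp [gen, hp, hq, hpX]

end Decoupling

/-- The operator that defines `singVec` maps a vacuum to a multiple of `s²ⁿ⁺¹ χ v`: `G² - 2 m K` acts
as `2 m s²`, and `G - 2 χ S` acts on `v` as `2 s χ`. -/
lemma Decoupling.IsCompatible.singular_smul {m : ℂ} [NeZero m] {V : Type*} [AddCommGroup V]
    [Module (Env m) V] [Module ℂ V] [IsScalarTower ℂ (Env m) V]
    {F : Decoupling (Module.End ℂ V) m} (hF : F.IsCompatible) {v : V} {d : ℝ}
    (hv : F.IsVacuum v d) (n : ℕ) :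
    ((SuperSchrodinger.gen m .G ^ 2 - scal m (2 * m) * SuperSchrodinger.gen m .K) ^ n *
      (SuperSchrodinger.gen m .G - scal m 2 * SuperSchrodinger.chi m *
        SuperSchrodinger.gen m .S)) • v =
      (2 * (2 * m) ^ n) • F.vec v 0 (2 * n + 1) true := by
  have hm := NeZero.ne m
  have h1 (x : V) : (SuperSchrodinger.gen m .G ^ 2 -
      scal m (2 * m) * SuperSchrodinger.gen m .K) • x = (2 * m) • F.s (F.s x) := by
    rw [sub_smul, mul_smul, scal_smul, pow_two, mul_smul, hF.G_smul, hF.G_smul, hF.gen_smul]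
    simp only [Decoupling.gen, LinearMap.add_apply, LinearMap.neg_apply, LinearMap.smul_apply,
      Module.End.mul_apply]
    match_scalars <;> field_simp
    ring
  have h2 : (SuperSchrodinger.gen m .G - scal m 2 * SuperSchrodinger.chi m *
      SuperSchrodinger.gen m .S) • v = (2 : ℂ) • F.vec v 0 1 true := by
    have hg (x : V) : F.chi (F.g x) = F.g (F.chi x) := LinearMap.congr_fun F.chi_g x
    have hs : F.chi (F.s v) = -F.s (F.chi v) := LinearMap.congr_fun F.chi_s v
    have hcc : F.chi (F.chi v) = (m / 2) • v := LinearMap.congr_fun F.chi_chi v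
    rw [sub_smul, mul_smul, mul_smul, scal_smul, hF.chi_smul, hF.G_smul, hF.gen_smul]
    simp only [Decoupling.gen, LinearMap.add_apply, LinearMap.smul_apply, Module.End.mul_apply,
      hv.X_eq, map_add, map_smul, hg, hs, hcc, Decoupling.vec, pow_zero, pow_one,
      Module.End.one_apply, if_true]
    match_scalars <;> field_simp
    ring
  rw [mul_smul, h2]
  induction n with
  | zero => simp
  | succ n ih =>
    rw [pow_succ', mul_smul, ih, h1, map_smul, map_smul, Decoupling.s_vec, Decoupling.s_vec,
      smul_smul]
    congr 1
    ring

section Submodules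

variable {d : ℝ} {m : ℂ} [NeZero m]

lemma basis_mem_of_repr_ne_zero (N : Submodule (Env m) (Verma d m)) {x : Verma d m} (hx : x ∈ N)
    {i : ℕ × ℕ × Bool} (hi : (vermaBasis d m).repr x i ≠ 0) : vermaBasis d m i ∈ N := by
  have hF := verma_isCompatible d m
  have hv := verma_isVacuum d m
  have hm := NeZero.ne m
  set F := vermaDecoupling d m with hFdef
  refine basis_mem_of_diagonal (vermaBasis d m) (N.restrictScalars ℂ) ?_ hx hi
  rintro ⟨a, k, e⟩ ⟨a', k', e'⟩ hne
  by_cases ha : a = a'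
  · by_cases hk : k = k'
    · refine ⟨F.X * F.chi, fun l => if l.2.2 then m / 2 else -(m / 2), ?_, ?_, ?_⟩
      · rintro ⟨a, k, e⟩
        rw [vermaBasis_apply]
        exact hv.X_chi_vec a k e
      · have he : e ≠ e' := by rintro rfl; exact hne (by rw [ha, hk])
        have hm2 : m / 2 ≠ -(m / 2) := by
          intro h
          exact hm (by linear_combination h)
        revert he
        cases e <;> cases e' <;> simp [hm2, hm2.symm]
      · intro x hx
        rw [Module.End.mul_apply, ← hF.X_smul, ← hF.chi_smul]
        exact N.smul_mem _ (N.smul_mem _ hx)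
    · refine ⟨F.q * F.s + F.s * F.q, fun l => (d : ℂ) + 1 / 2 - l.2.1, ?_, ?_, ?_⟩
      · rintro ⟨a, k, e⟩
        rw [vermaBasis_apply]
        exact hv.q_s_add_s_q_vec a k e
      · simpa using hk
      · intro x hx
        rw [LinearMap.add_apply, Module.End.mul_apply, Module.End.mul_apply, ← hF.redS_smul,
          ← hF.redS_smul, ← hF.redQ_smul, ← hF.redQ_smul]
        exact N.add_mem (N.smul_mem _ (N.smul_mem _ hx)) (N.smul_mem _ (N.smul_mem _ hx))
  · refine ⟨F.g * F.p, fun l => m * l.1, ?_, ?_, ?_⟩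
    · rintro ⟨a, k, e⟩
      rw [vermaBasis_apply]
      exact hv.g_p_vec a k e
    · simpa [hm] using ha
    · intro x hx
      rw [Module.End.mul_apply, ← hF.G_smul, ← hF.P_smul]
      exact N.smul_mem _ (N.smul_mem _ hx)

/-- A submodule contains `v₀` if it contains a vector with a monomial from which the exponent
of `s` can be lowered to `0`. -/
lemma vac_mem_of_repr_ne_zero (N : Submodule (Env m) (Verma d m)) {x : Verma d m} (hx : x ∈ N)
    {a k : ℕ} {e : Bool} (hi : (vermaBasis d m).repr x (a, k, e) ≠ 0)
    (hk : ∀ j : ℕ, j < k → lowerCoeff d (j + 1) ≠ 0) : vac d m ∈ N := by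
  have hF := verma_isCompatible d m
  have hv := verma_isVacuum d m
  have hm := NeZero.ne m
  have h0 := basis_mem_of_repr_ne_zero N hx hi
  have hscal (c : ℂ) (hc : c ≠ 0) (y : Verma d m) (hy : c • y ∈ N) : y ∈ N :=
    ((N.restrictScalars ℂ).smul_mem_iff hc).mp hy
  rw [vermaBasis_apply] at h0
  set F := vermaDecoupling d m with hFdef
  have h1 : F.vec (vac d m) 0 k e ∈ N := by
    clear hi
    induction a with
    | zero => exact h0
    | succ a ih =>
      refine ih (hscal (m * (a + 1 : ℕ)) (mul_ne_zero hm (by exact_mod_cast a.succ_ne_zero)) _ ?_)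
      have := hv.p_vec (a + 1) k e
      rw [Nat.add_sub_cancel] at this
      rw [← this, ← hF.P_smul]
      exact N.smul_mem _ h0
  have h2 : F.vec (vac d m) 0 0 e ∈ N := by
    clear hi h0
    induction k with
    | zero => exact h1
    | succ k ih =>
      refine ih (fun j hj => hk j (by omega)) (hscal _ (hk k (by omega)) _ ?_)
      have := hv.q_vec 0 (k + 1) e
      rw [Nat.add_sub_cancel] at this
      push_cast at this
      rw [← this, ← hF.redQ_smul]
      exact N.smul_mem _ h1
  cases e with
  | false => simpa [Decoupling.vec] using h2
  | true =>
    have h3 : F.chi (F.vec (vac d m) 0 0 true) ∈ N := by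
      rw [← hF.chi_smul]; exact N.smul_mem _ h2
    rw [Decoupling.chi_vec] at h3
    have h4 := hscal _ (by simpa using hm) _ h3
    simpa [Decoupling.vec] using h4

lemma eq_top_of_vac_mem {N : Submodule (Env m) (Verma d m)} (h : vac d m ∈ N) : N = ⊤ := by
  rw [eq_top_iff, ← (verma_isLowestWeightModule d m).span_eq_top]
  exact Submodule.span_le.mpr (by simpa using h)

lemma exists_of_lowerCoeff_eq_zero {j : ℕ} (h : lowerCoeff d (j + 1) = 0) :
    ∃ n : ℕ, d + 1 / 2 = n ∧ j = 2 * n := by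
  obtain ⟨n, rfl | rfl⟩ : ∃ n, j = 2 * n ∨ j = 2 * n + 1 := ⟨j / 2, by omega⟩
  · push_cast at h
    rw [lowerCoeff_two_mul_add_one] at h
    refine ⟨n, ?_, rfl⟩
    have h1 : (d : ℂ) + 1 / 2 = n := by
      push_cast at h
      linear_combination h
    have h2 : ((d + 1 / 2 : ℝ) : ℂ) = ((n : ℝ) : ℂ) := by push_cast; exact h1
    exact_mod_cast h2
  · have h1 : ((2 * n + 1 : ℕ) : ℤ) + 1 = 2 * (n + 1) := by push_cast; ring
    rw [h1, lowerCoeff_two_mul] at h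
    push_cast at h
    have : ((n + 1 : ℕ) : ℂ) = 0 := by push_cast; linear_combination -h
    exact absurd this (by exact_mod_cast n.succ_ne_zero)

variable (d m) in
lemma singVec_eq (n : ℕ) :
    singVec d m n = (2 * (2 * m) ^ n) • vermaBasis d m (0, 2 * n + 1, true) := by
  rw [vermaBasis_apply]
  exact (verma_isCompatible d m).singular_smul (verma_isVacuum d m) n

section Reducible

variable {n : ℕ} (hn : d + 1 / 2 = n)
include hn

lemma lowerCoeff_eq_zero : lowerCoeff d (2 * n + 1 : ℕ) = 0 := by
  push_cast
  rw [lowerCoeff_two_mul_add_one]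
  have : (d : ℂ) + 1 / 2 = n := by
    have := congrArg (fun r : ℝ => (r : ℂ)) hn
    push_cast at this
    exact this
  rw [this]
  simp

/-- The submodule generated by the singular vector is spanned by the monomials in which the
exponent of `s` exceeds `2 n`. -/
lemma mem_singSub_iff (x : Verma d m) :
    x ∈ singSub d m n ↔ ∀ i : ℕ × ℕ × Bool, i.2.1 ≤ 2 * n → (vermaBasis d m).repr x i = 0 := by
  have hF := verma_isCompatible d m
  have hv := verma_isVacuum d m
  have hm := NeZero.ne m
  set F := vermaDecoupling d m with hFdef
  set W := Submodule.span ℂ (vermaBasis d m '' {i | 2 * n + 1 ≤ i.2.1}) with hW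
  have hmem {a k e} (h : 2 * n + 1 ≤ k) : F.vec (vac d m) a k e ∈ W := by
    rw [← vermaBasis_apply]
    exact Submodule.subset_span ⟨_, h, rfl⟩
  have hstab (f : Module.End ℂ (Verma d m))
      (hf : ∀ a k e, 2 * n + 1 ≤ k → f (F.vec (vac d m) a k e) ∈ W) : ∀ x ∈ W, f x ∈ W := by
    intro x hx
    have : W ≤ W.comap f := Submodule.span_le.mpr (by
      rintro _ ⟨⟨a, k, e⟩, hi, rfl⟩
      rw [vermaBasis_apply]
      exact hf _ _ _ hi)
    exact this hx
  have hWsmul (a : Env m) {x} (hx : x ∈ W) : a • x ∈ W := by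
    refine hF.smul_mem W (hstab _ fun a k e h => ?_) (hstab _ fun a k e h => ?_)
      (hstab _ fun a k e h => ?_) (hstab _ fun a k e h => ?_) (hstab _ fun a k e h => ?_)
      (hstab _ fun a k e h => ?_) a hx
    · rw [Decoupling.g_vec]; exact hmem h
    · rw [hv.p_vec]; exact W.smul_mem _ (hmem h)
    · rw [hv.X_vec]; exact W.smul_mem _ (hmem h)
    · rw [Decoupling.chi_vec]; exact W.smul_mem _ (hmem h)
    · rw [Decoupling.s_vec]; exact hmem (by omega)
    · rw [hv.q_vec]
      rcases h.eq_or_lt with rfl | h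
      · rw [lowerCoeff_eq_zero hn]
        exact (zero_smul ℂ (_ : Verma d m)).symm ▸ W.zero_mem
      · exact W.smul_mem _ (hmem (by omega))
  have hc : 2 * (2 * m) ^ n ≠ 0 := by simp [hm]
  have hsing : F.vec (vac d m) 0 (2 * n + 1) true ∈ singSub d m n := by
    have h : singVec d m n ∈ (singSub d m n).restrictScalars ℂ :=
      Submodule.mem_span_singleton_self _
    rw [singVec_eq, vermaBasis_apply] at h
    exact (Submodule.smul_mem_iff ((singSub d m n).restrictScalars ℂ) hc).mp h
  have hle : W ≤ (singSub d m n).restrictScalars ℂ := by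
    refine Submodule.span_le.mpr ?_
    rintro _ ⟨⟨a, k, e⟩, hi, rfl⟩
    rw [vermaBasis_apply]
    obtain ⟨j, rfl⟩ := Nat.exists_eq_add_of_le (show 2 * n + 1 ≤ k from hi)
    clear hi
    change F.vec (vac d m) a (2 * n + 1 + j) e ∈ singSub d m n
    induction a with
    | succ a ih => rw [← Decoupling.g_vec, ← hF.G_smul]; exact Submodule.smul_mem _ _ ih
    | zero =>
      induction j with
      | succ j ih =>
        rw [← add_assoc, ← Decoupling.s_vec, ← hF.redS_smul]
        exact Submodule.smul_mem _ _ ih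
      | zero =>
        cases e with
        | true => exact hsing
        | false =>
          have h := (singSub d m n).smul_mem (chi m) hsing
          rw [hF.chi_smul, Decoupling.chi_vec] at h
          exact (Submodule.smul_mem_iff ((singSub d m n).restrictScalars ℂ)
            (by simp [hm])).mp h
  have hxW : x ∈ singSub d m n ↔ x ∈ W := by
    refine ⟨fun hx => ?_, fun hx => hle hx⟩
    obtain ⟨a, rfl⟩ := Submodule.mem_span_singleton.mp hx
    rw [singVec_eq, vermaBasis_apply]
    exact hWsmul a (W.smul_mem _ (hmem le_rfl))
  rw [hxW, hW, Module.Basis.mem_span_image]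
  refine ⟨fun h i hi => ?_, fun h i hi => ?_⟩
  · by_contra hne
    have := h (Finsupp.mem_support_iff.mpr hne)
    change 2 * n + 1 ≤ i.2.1 at this
    omega
  · by_contra hlt
    change ¬ 2 * n + 1 ≤ i.2.1 at hlt
    exact Finsupp.mem_support_iff.mp hi (h i (by omega))

lemma vac_notMem_singSub : vac d m ∉ singSub d m n := by
  rw [mem_singSub_iff hn]
  intro h
  have := h (0, 0, false) (Nat.zero_le _)
  rw [← vermaBasis_zero] at this
  simp at this

/-- Every submodule that is not contained in `singSub d m n` is the whole Verma module. -/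
lemma eq_top_of_not_le_singSub {N : Submodule (Env m) (Verma d m)} (hN : ¬ N ≤ singSub d m n) :
    N = ⊤ := by
  obtain ⟨x, hx, hxn⟩ := SetLike.not_le_iff_exists.mp hN
  rw [mem_singSub_iff hn] at hxn
  push Not at hxn
  obtain ⟨⟨a, k, e⟩, hk, hne⟩ := hxn
  refine eq_top_of_vac_mem (vac_mem_of_repr_ne_zero N hx hne fun j hj h0 => ?_)
  obtain ⟨n', hn', rfl⟩ := exists_of_lowerCoeff_eq_zero h0
  have : n = n' := by exact_mod_cast hn.symm.trans hn'
  change k ≤ 2 * n at hk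
  omega

lemma isCoatom_singSub : IsCoatom (singSub d m n) :=
  ⟨fun h => vac_notMem_singSub hn (h ▸ Submodule.mem_top),
    fun _ hN => eq_top_of_not_le_singSub hn hN.not_ge⟩

lemma singVec_isSingularVector : IsSingularVector d m (singVec d m n) := by
  have hF := verma_isCompatible d m
  have hv := verma_isVacuum d m
  have hm := NeZero.ne m
  refine ⟨⟨((0 : ℕ) : ℂ) + (2 * n + 1 : ℕ) - d, ?_⟩, fun a b h => ?_, fun x hx => ?_⟩
  · rw [singVec_eq, vermaBasis_apply, hF.gen_smul, map_smul, hv.D_vec hm, scal_smul, smul_comm]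
  · have h1 : (scal m a + scal m b * chi m) • vac d m =
        a • vermaBasis d m (0, 0, false) + b • vermaBasis d m (0, 0, true) := by
      rw [add_smul, mul_smul, scal_smul, scal_smul, hF.chi_smul, vermaBasis_apply,
        vermaBasis_apply]
      simp [Decoupling.vec]
    rw [h1, singVec_eq] at h
    have h2 := congrArg (fun y => (vermaBasis d m).repr y (0, 2 * n + 1, true)) h
    simp at h2
    exact hm h2.1
  · rw [singVec_eq, vermaBasis_apply, hF.gen_smul, map_smul]
    rw [hv.gen_vec_eq_zero (lowerCoeff_eq_zero hn) true hx]
    exact smul_zero (A := Verma d m) (2 * (2 * m) ^ n)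

lemma vermaQuot_isLowestWeightModule :
    IsLowestWeightModule d m (VermaQuot d m n) (vacQuot d m n) := by
  have h := verma_isLowestWeightModule d m
  have hmap (a : Env m) : a • vacQuot d m n = (singSub d m n).mkQ (a • vac d m) :=
    (map_smul _ _ _).symm
  refine ⟨⟨fun h0 => ?_, fun x hx => ?_, ?_, ?_, ?_⟩, ?_⟩
  · exact vac_notMem_singSub hn ((Submodule.Quotient.mk_eq_zero _).mp h0)
  · rw [hmap, h.lowest.neg_smul x hx, map_zero]
  · rw [hmap, hmap, h.lowest.D_smul]
  · rw [hmap, hmap, h.lowest.M_smul]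
  · rw [hmap, hmap, h.lowest.X_smul]
  · rw [vacQuot, ← Set.image_singleton, ← Submodule.map_span, h.span_eq_top, Submodule.map_top,
      Submodule.range_mkQ]

end Reducible

lemma verma_isSimpleModule (hd : ¬ ∃ n : ℕ, d + 1 / 2 = n) :
    IsSimpleModule (Env m) (Verma d m) := by
  have hne := (verma_isLowestWeightModule d m).lowest.ne_zero
  have : Nontrivial (Verma d m) := ⟨⟨_, _, hne⟩⟩
  rw [isSimpleModule_iff, isSimpleOrder_iff]
  refine ⟨inferInstance, fun N => or_iff_not_imp_left.mpr fun hN => ?_⟩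
  obtain ⟨x, hx, hx0⟩ := N.ne_bot_iff.mp hN
  obtain ⟨⟨a, k, e⟩, hi⟩ : ∃ i, (vermaBasis d m).repr x i ≠ 0 := by
    by_contra! h
    exact hx0 ((vermaBasis d m).repr.map_eq_zero_iff.mp (Finsupp.ext h))
  refine eq_top_of_vac_mem (vac_mem_of_repr_ne_zero N hx hi fun j _ h0 => ?_)
  obtain ⟨n, hn, -⟩ := exists_of_lowerCoeff_eq_zero h0
  exact hd ⟨n, hn⟩

lemma verma_not_isSimpleModule {n : ℕ} (hn : d + 1 / 2 = n) :
    ¬ IsSimpleModule (Env m) (Verma d m) := by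
  intro h
  rcases eq_bot_or_eq_top (singSub d m n) with h0 | h1
  · have h2 : singVec d m n = 0 := by
      rw [← Submodule.mem_bot (Env m), ← h0]
      exact Submodule.mem_span_singleton_self _
    exact (singVec_isSingularVector hn).not_multiple 0 0 (by rw [h2]; simp)
  · exact (isCoatom_singSub hn).1 h1

end Submodules

end SuperSchrodinger

theorem proposition2 (d : ℝ) (m : ℂ) (hm : m ≠ 0) :
    -- the Verma module is a lowest weight module, irreducible iff `d + 1/2` is not in `ℤ_{≥ 0}`
    (IsLowestWeightModule d m (Verma d m) (vac d m) ∧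
      (IsSimpleModule (Env m) (Verma d m) ↔ ¬ ∃ n : ℕ, d + 1 / 2 = n)) ∧
    -- otherwise the quotient by the submodule generated by the singular vector is irreducible
    (∀ n : ℕ, d + 1 / 2 = n →
      IsSingularVector d m (singVec d m n) ∧
      IsLowestWeightModule d m (VermaQuot d m n) (vacQuot d m n) ∧
      IsSimpleModule (Env m) (VermaQuot d m n)) ∧
    -- every irreducible lowest weight module is one of these
    (∀ (V : Type u) [AddCommGroup V] [Module (Env m) V] (v : V),
      IsLowestWeightModule d m V v → IsSimpleModule (Env m) V →
        ((¬ ∃ n : ℕ, d + 1 / 2 = n) → ∃ e : Verma d m ≃ₗ[Env m] V, e (vac d m) = v) ∧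
        (∀ n : ℕ, d + 1 / 2 = n →
          ∃ e : VermaQuot d m n ≃ₗ[Env m] V, e (vacQuot d m n) = v)) ∧
    -- the irreducible modules in the list are infinite dimensional
    ((¬ ∃ n : ℕ, d + 1 / 2 = n) → ¬ FiniteDimensional ℂ (Verma d m)) ∧
    (∀ n : ℕ, d + 1 / 2 = n → ¬ FiniteDimensional ℂ (VermaQuot d m n)) := by
  have : NeZero m := ⟨hm⟩
  have hV := verma_isLowestWeightModule d m
  refine ⟨⟨hV, fun h => ?_, verma_isSimpleModule⟩, fun n hn => ⟨singVec_isSingularVector hn,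
    vermaQuot_isLowestWeightModule hn, isSimpleModule_iff_isCoatom.mpr (isCoatom_singSub hn)⟩,
    fun V _ _ v hv hs => ?_, fun _ => ?_, fun n hn => ?_⟩
  · rintro ⟨n, hn⟩
    exact verma_not_isSimpleModule hn h
  · obtain ⟨f, hf⟩ := exists_verma_hom hv.lowest
    have hsurj : Function.Surjective f := by
      rw [← LinearMap.range_eq_top, eq_top_iff, ← hv.span_eq_top]
      exact Submodule.span_le.mpr (by simpa using ⟨vac d m, hf⟩)
    let e := f.quotKerEquivOfSurjective hsurj
    have hker : IsCoatom (LinearMap.ker f) :=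
      isSimpleModule_iff_isCoatom.mp (IsSimpleModule.congr e)
    refine ⟨fun hd => ?_, fun n hn => ?_⟩
    · have := verma_isSimpleModule (m := m) hd
      have hbot : LinearMap.ker f = ⊥ := (eq_bot_or_eq_top _).resolve_right hker.1
      exact ⟨LinearEquiv.ofBijective f ⟨LinearMap.ker_eq_bot.mp hbot, hsurj⟩, hf⟩
    · -- The kernel lies in the coatom generated by the singular vector, so it equals it.
      have hle : LinearMap.ker f ≤ singSub d m n :=
        not_not.mp fun h => hker.1 (eq_top_of_not_le_singSub hn h)
      have heq : singSub d m n = LinearMap.ker f :=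
        ((hker.le_iff.mp hle).resolve_left (isCoatom_singSub hn).1)
      refine ⟨(Submodule.quotEquivOfEq _ _ heq).trans e, ?_⟩
      exact hf
  · have : Nontrivial (Verma d m) := ⟨⟨_, _, hV.lowest.ne_zero⟩⟩
    exact hV.hasMass.not_finiteDimensional
  · have hQ := vermaQuot_isLowestWeightModule (m := m) hn
    have : Nontrivial (VermaQuot d m n) := ⟨⟨_, _, hQ.lowest.ne_zero⟩⟩
    exact hQ.hasMass.not_finiteDimensional
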